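/- Let $\mathbf{k}$ be a field and $(R,\le)$ a total order. An interval in $R$ is a non-empty subset $I\subseteq R$ such that $s\le u\le t$ with $s,t\in I$ implies $u\in I$; it is left separable if there is a countable $S\subseteq I$ such that every $t\in I$ satisfies $s\le t$ for some $s\in S$. Assume that every interval in $R$ is left separable (for example $R=\mathbb{R}$). A persistence module $V$ over $R$ is a functor from $R$ to $\mathbf{k}$-vector spaces, with structure maps $\rho_{ts}:V_s\to V_t$ for $s\le t$. It is q-tame if $\rho_{ts}$ has finite rank whenever $s<t$, and ephemeral if $\rho_{ts}=0$ whenever $s<t$. Its radical is the submodule $\operatorname{rad}V$ with $(\operatorname{rad}V)_t=\sum_{s<t}\operatorname{Im}\rho_{ts}$, and $V$ is radical if $V=\operatorname{rad}V$. The interval module $\mathbf{k}_I$ is $\mathbf{k}$ at every $t\in I$ and $0$ elsewhere, with identity maps between indices in $I$. Direct sums of persistence modules are formed pointwise. A morphism of persistence modules is a weak isomorphism if its kernel and cokernel are ephemeral. If $R$ is dense (for all $s<t$ there is $u$ with $s<u<t$), the observable category $\mathbf{Ob}$ has the persistence modules as objects; a morphism $V\to W$ in $\mathbf{Ob}$ is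 a family of linear maps $\phi_{ts}:V_s\to W_t$, $s<t$, with $\phi_{ts}=\sigma_{tv}\phi_{vu}\rho_{us}$ whenever $s\le u<v\le t$ ($\rho,\sigma$ the structure maps of $V,W$). Composition is $(\psi\phi)_{ts}=\psi_{tu}\phi_{us}$ for any $u$ with $s<u<t$, and the identity of $V$ is $(\rho_{ts})_{s<t}$. There is a functor $\pi$ from persistence modules to $\mathbf{Ob}$ which is the identity on objects and sends $(\phi_t)_t$ to $(\phi_t\rho_{ts})_{s<t}$. Then: 1. Every radical q-tame persistence module over $R$ is isomorphic, as a persistence module, to a direct sum of interval modules. 2. Suppose moreover that $R$ is dense. For every persistence module $V$, the module $\operatorname{rad}V$ is radical and the inclusion $\operatorname{rad}V\to V$ is a weak isomorphism. If $V$ is q-tame, then $\operatorname{rad}V$ is q-tame, and there is a family $(I_i)_i$ of intervals in $R$ such that $\operatorname{rad}V\cong\bigoplus_i\mathbf{k}_{I_i}$ as persistence modules and $V\cong\bigoplus_i\mathbf{k}_{I_i}$ in $\mathbf{Ob}$; moreover $\bigoplus_i\mathbf{k}_{I_i}$, with the images under $\pi$ of the inclusions of its summands, is the coproduct of the $\mathbf{k}_{I_i}$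 in $\mathbf{Ob}$. -/

import Mathlib

open CategoryTheory CategoryTheory.Limits

universe u v w

noncomputable section

namespace Persistence

section Order

/-- An interval of an ordered set: a non-empty order-convex subset. -/
structure OrdInterval (R : Type u) [LinearOrder R] where
  carrier : Set R
  nonempty : carrier.Nonempty
  convex : ∀ ⦃s u t : R⦄, s ∈ carrier → t ∈ carrier → s ≤ u → u ≤ t → u ∈ carrier

/-- An interval is left separable if it has a countable subset that is coinitial in it. -/
def LeftSeparable {R : Type u} [LinearOrder R] (I : OrdInterval R) : Prop :=
  ∃ S : Set R, S ⊆ I.carrier ∧ S.Countable ∧ ∀ t ∈ I.carrier, ∃ s ∈ S, s ≤ t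

/-- Every interval of the real line is left separable. -/
theorem leftSeparable_real (I : OrdInterval ℝ) : LeftSeparable I := by
  classical
  by_cases hm : ∃ m ∈ I.carrier, ∀ t ∈ I.carrier, m ≤ t
  · obtain ⟨m, hm, h⟩ := hm
    exact ⟨{m}, by simpa using hm, Set.countable_singleton m, fun t ht => ⟨m, rfl, h t ht⟩⟩
  · push Not at hm
    refine ⟨I.carrier ∩ Set.range ((↑) : ℚ → ℝ), Set.inter_subset_left,
      (Set.countable_range _).mono Set.inter_subset_right, fun t ht => ?_⟩
    obtain ⟨s, hs, hst⟩ := hm t ht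
    obtain ⟨q, hq1, hq2⟩ := exists_rat_btwn hst
    exact ⟨q, ⟨I.convex hs ht hq1.le hq2.le, q, rfl⟩, hq2.le⟩

end Order

variable {R : Type u} [LinearOrder R] {k : Type v} [Field k]

section Modules

/-- The structure map `V s → V t` of a persistence module, for `s ≤ t`. -/
def transition (V : R ⥤ ModuleCat.{w} k) {s t : R} (h : s ≤ t) : V.obj s →ₗ[k] V.obj t :=
  (V.map (homOfLE h)).hom

/-- `V` is q-tame if the structure map `V s → V t` has finite rank whenever `s < t`. -/
def IsQTame (V : R ⥤ ModuleCat.{w} k) : Prop :=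
  ∀ ⦃s t : R⦄ (h : s < t), FiniteDimensional k (LinearMap.range (transition V h.le))

/-- `V` is ephemeral if the structure map `V s → V t` vanishes whenever `s < t`. -/
def IsEphemeral (V : R ⥤ ModuleCat.{w} k) : Prop :=
  ∀ ⦃s t : R⦄ (h : s < t), transition V h.le = 0

/-- A weak isomorphism: a morphism with ephemeral kernel and cokernel. -/
def IsWeakIso {V W : R ⥤ ModuleCat.{w} k} (φ : V ⟶ W) : Prop :=
  IsEphemeral (kernel φ) ∧ IsEphemeral (cokernel φ)

end Modules

section Radical

/-- The radical at index `t`: the sum of the images of the structure maps `V s → V t`, `s < t`. -/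
def radAt (V : R ⥤ ModuleCat.{w} k) (t : R) : Submodule k (V.obj t) :=
  ⨆ s : {s : R // s < t}, LinearMap.range (transition V s.2.le)

theorem radAt_le_comap (V : R ⥤ ModuleCat.{w} k) {s t : R} (h : s ≤ t) :
    radAt V s ≤ (radAt V t).comap (transition V h) := by
  refine iSup_le fun r => ?_
  rintro _ ⟨x, rfl⟩
  refine Submodule.mem_iSup_of_mem ⟨r.1, r.2.trans_le h⟩ ⟨x, ?_⟩
  simp only [transition, ← homOfLE_comp r.2.le h, V.map_comp, ModuleCat.hom_comp,
    LinearMap.comp_apply]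

/-- The radical of a persistence module, as a persistence module. -/
def rad (V : R ⥤ ModuleCat.{w} k) : R ⥤ ModuleCat.{w} k where
  obj t := ModuleCat.of k (radAt V t)
  map f := ModuleCat.ofHom ((transition V (leOfHom f)).restrict (radAt_le_comap V (leOfHom f)))
  map_id t := by
    ext x
    exact congrArg (fun g => g.hom x.1) (V.map_id t)
  map_comp {s t r} f g := by
    ext x
    exact congrArg (fun g => g.hom x.1) (V.map_comp f g)

/-- The inclusion of the radical. -/
def radInclusion (V : R ⥤ ModuleCat.{w} k) : rad V ⟶ V where
  app t := ModuleCat.ofHom (radAt V t).subtype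
  naturality _ _ _ := rfl

/-- `V` is radical if it is equal to its radical. -/
def IsRadicalModule (V : R ⥤ ModuleCat.{w} k) : Prop :=
  ∀ t : R, radAt V t = ⊤

end Radical

section DirectSums

/-- The direct sum of a family of persistence modules, formed index by index. -/
def directSum {ι : Type w} (F : ι → R ⥤ ModuleCat.{w} k) : R ⥤ ModuleCat.{w} k where
  obj t := ModuleCat.of k (Π₀ i, (F i).obj t)
  map f := ModuleCat.ofHom (DFinsupp.mapRange.linearMap fun i => ((F i).map f).hom)
  map_id t := by
    refine ModuleCat.hom_ext (LinearMap.ext fun x => DFinsupp.ext fun i => ?_)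
    exact congrArg (fun g => g.hom (x i)) ((F i).map_id t)
  map_comp {s t r} f g := by
    refine ModuleCat.hom_ext (LinearMap.ext fun x => DFinsupp.ext fun i => ?_)
    exact congrArg (fun g => g.hom (x i)) ((F i).map_comp f g)

open Classical in
/-- The inclusion of a summand into the direct sum. -/
def directSumInclusion {ι : Type w} (F : ι → R ⥤ ModuleCat.{w} k) (i : ι) :
    F i ⟶ directSum F where
  app t := ModuleCat.ofHom (DFinsupp.lsingle (R := k) (M := fun j => (F j).obj t) i)
  naturality s t f := by
    ext x
    exact (DFinsupp.mapRange_single (f := fun j => ((F j).map f).hom)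
      (hf := fun j => map_zero _) (i := i) (b := x)).symm

end DirectSums

section IntervalModules

/-- The value at `t` of the interval module of `I`, as a subspace of `k`:
all of `k` if `t ∈ I`, and `0` otherwise. -/
def intervalSpace (k : Type v) [Field k] (I : OrdInterval R) (t : R) : Submodule k k where
  carrier := {x | t ∉ I.carrier → x = 0}
  add_mem' ha hb h := by rw [ha h, hb h, add_zero]
  zero_mem' _ := rfl
  smul_mem' c x hx h := by rw [hx h, smul_zero]

open Classical in
/-- The structure map of the interval module into index `t`:
the identity of `k` if `t ∈ I`, and `0` otherwise. -/
def intervalMap (k : Type v) [Field k] (I : OrdInterval R) (s t : R) :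
    intervalSpace k I s →ₗ[k] intervalSpace k I t where
  toFun x := ⟨if t ∈ I.carrier then x.1 else 0, fun h => if_neg h⟩
  map_add' x y := by
    apply Subtype.ext
    by_cases h : t ∈ I.carrier <;> simp [h]
  map_smul' c x := by
    apply Subtype.ext
    by_cases h : t ∈ I.carrier <;> simp [h]

/-- The interval module of `I`: it is `k` on `I` and `0` elsewhere, with identity maps within `I`.
The lift only adjusts the universe. -/
def intervalModule (k : Type v) [Field k] (I : OrdInterval R) : R ⥤ ModuleCat.{max v w} k where
  obj t := ModuleCat.of k (ULift.{w} (intervalSpace k I t))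
  map {s t} _ := ModuleCat.ofHom
    (ULift.moduleEquiv.symm.toLinearMap ∘ₗ intervalMap k I s t ∘ₗ ULift.moduleEquiv.toLinearMap)
  map_id t := by
    refine ModuleCat.hom_ext (LinearMap.ext fun x => ULift.ext _ _ (Subtype.ext ?_))
    obtain ⟨x, hx⟩ := x
    by_cases h : t ∈ I.carrier
    · simp [intervalMap, h]
    · simp [intervalMap, h, hx h]
  map_comp {s t r} f g := by
    refine ModuleCat.hom_ext (LinearMap.ext fun x => ULift.ext _ _ (Subtype.ext ?_))
    obtain ⟨x, hx⟩ := x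
    by_cases hr : r ∈ I.carrier
    · by_cases ht : t ∈ I.carrier
      · simp [intervalMap, hr, ht]
      · have hs : s ∉ I.carrier := fun hs => ht (I.convex hs hr (leOfHom f) (leOfHom g))
        simp [intervalMap, ht, hx hs]
    · simp [intervalMap, hr]

end IntervalModules

section Observable

/-- An object of the observable category is a persistence module. -/
structure Ob (R : Type u) [LinearOrder R] (k : Type v) [Field k] where
  pers : R ⥤ ModuleCat.{w} k

/-- An observable morphism: maps `V s → W t` for `s < t` only, compatible with structure maps. -/
@[ext]
structure ObHom (V W : R ⥤ ModuleCat.{w} k) where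
  app : ∀ ⦃s t : R⦄, s < t → (V.obj s ⟶ W.obj t)
  comm : ∀ ⦃s u v t : R⦄ (hsu : s ≤ u) (huv : u < v) (hvt : v ≤ t),
    app ((hsu.trans_lt huv).trans_le hvt) = V.map (homOfLE hsu) ≫ app huv ≫ W.map (homOfLE hvt)

/-- The observable morphism obtained from a morphism: its components are `V s → V t → W t`. -/
def ObHom.ofHom {V W : R ⥤ ModuleCat.{w} k} (φ : V ⟶ W) : ObHom V W where
  app s t h := V.map (homOfLE h.le) ≫ φ.app t
  comm s u v t hsu huv hvt := by
    rw [Category.assoc, ← φ.naturality, ← Category.assoc (V.map (homOfLE huv.le)), ← V.map_comp,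
      ← Category.assoc, ← V.map_comp]
    rfl

theorem ObHom.app_map {V W : R ⥤ ModuleCat.{w} k} (φ : ObHom V W) {s v t : R}
    (h : s < v) (hvt : v ≤ t) : φ.app h ≫ W.map (homOfLE hvt) = φ.app (h.trans_le hvt) := by
  rw [φ.comm le_rfl h hvt, show homOfLE (le_refl s) = 𝟙 s from rfl, V.map_id, Category.id_comp]

theorem ObHom.map_app {V W : R ⥤ ModuleCat.{w} k} (φ : ObHom V W) {s u t : R}
    (hsu : s ≤ u) (h : u < t) : V.map (homOfLE hsu) ≫ φ.app h = φ.app (hsu.trans_lt h) := by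
  rw [φ.comm hsu h le_rfl, show homOfLE (le_refl t) = 𝟙 t from rfl, W.map_id, Category.comp_id]

/-- The composite `V s → W u → X t` does not depend on the intermediate index. -/
theorem ObHom.comp_indep {V W X : R ⥤ ModuleCat.{w} k} (φ : ObHom V W) (ψ : ObHom W X)
    {s t u v : R} (hsu : s < u) (hut : u < t) (hsv : s < v) (hvt : v < t) :
    φ.app hsu ≫ ψ.app hut = φ.app hsv ≫ ψ.app hvt := by
  rcases le_total u v with h | h
  · rw [← ψ.map_app h hvt, ← Category.assoc, φ.app_map]
  · rw [← ψ.map_app h hut, ← Category.assoc, φ.app_map]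

variable [DenselyOrdered R]

/-- Composition of observable morphisms, through any intermediate index. -/
def ObHom.comp {V W X : R ⥤ ModuleCat.{w} k} (φ : ObHom V W) (ψ : ObHom W X) : ObHom V X where
  app s t h := φ.app (exists_between h).choose_spec.1 ≫ ψ.app (exists_between h).choose_spec.2
  comm s u v t hsu huv hvt := by
    obtain ⟨h1, h2⟩ := (exists_between huv).choose_spec
    rw [Category.assoc, ψ.app_map, ← Category.assoc, φ.map_app]
    exact φ.comp_indep ψ _ _ _ _

theorem ObHom.comp_app {V W X : R ⥤ ModuleCat.{w} k} (φ : ObHom V W) (ψ : ObHom W X)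
    {s u t : R} (hsu : s < u) (hut : u < t) :
    (φ.comp ψ).app (hsu.trans hut) = φ.app hsu ≫ ψ.app hut :=
  φ.comp_indep ψ _ _ _ _

/-- The observable category of persistence modules over a dense order. -/
instance : Category (Ob.{u, v, w} R k) where
  Hom V W := ObHom V.pers W.pers
  id V := ObHom.ofHom (𝟙 V.pers)
  comp φ ψ := φ.comp ψ
  id_comp φ := by
    refine ObHom.ext ?_
    funext s t h
    obtain ⟨u, hsu, hut⟩ := exists_between h
    rw [ObHom.comp_app _ _ hsu hut]
    simp [ObHom.ofHom, ObHom.map_app]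
  comp_id φ := by
    refine ObHom.ext ?_
    funext s t h
    obtain ⟨u, hsu, hut⟩ := exists_between h
    rw [ObHom.comp_app _ _ hsu hut]
    simp [ObHom.ofHom, ObHom.app_map]
  assoc φ ψ χ := by
    refine ObHom.ext ?_
    funext s t h
    obtain ⟨u, hsu, hut⟩ := exists_between h
    obtain ⟨r, hur, hrt⟩ := exists_between hut
    rw [ObHom.comp_app _ _ (hsu.trans hur) hrt, ObHom.comp_app _ _ hsu hur,
      ObHom.comp_app _ _ hsu hut, ObHom.comp_app _ _ hur hrt, Category.assoc]

/-- The functor from persistence modules to the observable category: the identity on objects,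
forgetting the components `V t → W t` of a morphism. -/
def toOb (R : Type u) [LinearOrder R] [DenselyOrdered R] (k : Type v) [Field k] :
    (R ⥤ ModuleCat.{w} k) ⥤ Ob.{u, v, w} R k where
  obj V := ⟨V⟩
  map φ := ObHom.ofHom φ
  map_comp {V W X} φ ψ := by
    refine ObHom.ext ?_
    funext s t h
    obtain ⟨u, hsu, hut⟩ := exists_between h
    refine Eq.trans ?_ (ObHom.comp_app (ObHom.ofHom φ) (ObHom.ofHom ψ) hsu hut).symm
    simp only [ObHom.ofHom, NatTrans.comp_app, Category.assoc]
    rw [← φ.naturality_assoc, ← V.map_comp_assoc]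
    rfl

/-- The cocone of the direct sum in the observable category: its point is the direct sum formed
index by index. -/
def obDirectSumCofan {ι : Type w} (F : ι → R ⥤ ModuleCat.{w} k) :
    Cofan fun i => (toOb R k).obj (F i) :=
  Cofan.mk ((toOb R k).obj (directSum F)) fun i => (toOb R k).map (directSumInclusion F i)

end Observable

end Persistence

end

open Persistence

/-! An interval summand is determined by where it ends, a lower set `D` of `R`, and by a vector
saying when it starts. For fixed `D`, take the colimit of `V` over `D`, filtered by the images of
the `V s`, and inside it the subspace `dyingColim` of classes that vanish beyond `D`. Q-tameness
makes the steps of the filtration finite-dimensional, except possibly at a greatest index of `D`. So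
`dyingColim` has a basis adapted to the filtration, with dual functionals on the whole colimit that
respect it (`exists_adapted_functionals`). A basis vector `b` gives the interval of all `s ∈ D` with
`b` in the image of `V s`; its functional gives a morphism from `V` to that interval module.

Together these morphisms identify `V` with the direct sum (`exists_interval_functionals`). They are
jointly injective because a nonzero vector is detected at the lower set on which it survives. For `s
< t`, the functionals whose intervals contain both indices are linearly independent on the
finite-dimensional image of `V s` in `V t`, by triangularity with respect to inclusion of lower
sets. Radicality places every vector in such an image, which yields local finiteness and
surjectivity.

In the dense case, a structure map `V s → V t` with `s < t` lands in the radical and so inverts the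
inclusion in the observable category; the decomposition of `rad V` is carried over to `V`. -/

namespace Persistence

/-! ### Bases and functionals adapted to a filtration -/

section LinearAlgebra

variable {k E : Type*} [Field k] [AddCommGroup E] [Module k E]

/-- A chain of finite-dimensional subspaces has an adapted basis. -/
theorem exists_adapted_basis (C : Set (Submodule k E)) (hC : IsChain (· ≤ ·) C)
    (hfd : ∀ W ∈ C, FiniteDimensional k W) :
    ∃ B : Set E, LinearIndepOn k id B ∧ B ⊆ (sSup C : Submodule k E) ∧
      ∀ W ∈ C, W ≤ Submodule.span k (B ∩ W) := by
  -- In a chain, dimension determines a finite-dimensional member. The chain can thus be reindexed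
  -- by `ℕ`, and a basis extended one step at a time.
  let G : ℕ → Submodule k E := fun n => sSup {W ∈ C | Module.finrank k W ≤ n}
  have hG : Monotone G := fun m n h => sSup_le_sSup fun W hW => ⟨hW.1, hW.2.trans h⟩
  have hWG : ∀ W ∈ C, G (Module.finrank k W) = W := by
    intro W hW
    have := hfd W hW
    refine le_antisymm (sSup_le fun W' hW' => ?_) (le_sSup ⟨hW, le_rfl⟩)
    rcases hC.total hW'.1 hW with h | h
    · exact h
    · have := hfd W' hW'.1
      exact (Submodule.eq_of_le_of_finrank_le h hW'.2).ge
  let T : ℕ → Type _ := fun n =>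
    {s : Set E // LinearIndepOn k id s ∧ s ⊆ G n ∧ G n ≤ Submodule.span k s}
  have step : ∀ n (s : Set E), LinearIndepOn k id s → s ⊆ G n → ∃ s' : T n, s ⊆ s'.1 :=
    fun n s hs hsG => ⟨⟨hs.extend hsG, hs.linearIndepOn_extend hsG, hs.extend_subset hsG,
      hs.subset_span_extend hsG⟩, hs.subset_extend hsG⟩
  have hGs : ∀ n, (G n : Set E) ⊆ G (n + 1) := fun n => hG n.le_succ
  let b : ∀ n, T n := fun n => Nat.rec
    (step 0 ∅ (linearIndepOn_empty k id) (Set.empty_subset _)).choose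
    (fun n s => (step (n + 1) s.1 s.2.1 (s.2.2.1.trans (hGs n))).choose) n
  have hb : Monotone fun n => (b n).1 := monotone_nat_of_le_succ fun n =>
    (step (n + 1) (b n).1 (b n).2.1 ((b n).2.2.1.trans (hGs n))).choose_spec
  refine ⟨⋃ n, (b n).1, linearIndepOn_iUnion_of_directed hb.directed_le fun n => (b n).2.1,
    Set.iUnion_subset fun n => (b n).2.2.1.trans ?_, fun W hW => ?_⟩
  · exact (sSup_le_sSup fun W hW => hW.1 : G n ≤ sSup C)
  · obtain ⟨-, h1, h2⟩ := (b (Module.finrank k W)).2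
    exact (hWG W hW).ge.trans (h2.trans (Submodule.span_mono (Set.subset_inter
      (Set.subset_iUnion_of_subset _ le_rfl) (h1.trans (hWG W hW).le))))

/-- A subspace filtered by a chain of subspaces has a basis with dual functionals on the whole
space, each of which vanishes on the steps of the filtration not containing its vector. -/
theorem exists_adapted_functionals {S : Type*} [LinearOrder S] (K : Submodule k E)
    (P : S → Submodule k E) (hP : Monotone P)
    (hfd : ∀ s, FiniteDimensional k (P s) ∨ P s = ⊤)
    (hK : ∀ x ∈ K, ∃ s, FiniteDimensional k (P s) ∧ x ∈ P s) :
    ∃ (B : Set E) (f : B → E →ₗ[k] k),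
      (∀ b : B, b.1 ∈ K) ∧ (∀ b : B, f b b = 1) ∧ (∀ b c : B, b ≠ c → f b c = 0) ∧
      (∀ (b : B) (s : S), b.1 ∉ P s → ∀ x ∈ P s, f b x = 0) ∧
      ∀ x ∈ K, (∀ b, f b x = 0) → x = 0 := by
  obtain ⟨B, hB, hBK, hspan⟩ := exists_adapted_basis
    {W | ∃ s, FiniteDimensional k (P s) ∧ W = P s ⊓ K} (by
      rintro _ ⟨s, -, rfl⟩ _ ⟨t, -, rfl⟩ -
      exact (le_total s t).imp (fun h => inf_le_inf_right _ (hP h))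
        fun h => inf_le_inf_right _ (hP h)) (by
      rintro _ ⟨s, hs, rfl⟩
      exact Submodule.finiteDimensional_of_le inf_le_left)
  replace hBK : ∀ b ∈ B, b ∈ K := fun b hb =>
    (sSup_le (by rintro _ ⟨s, -, rfl⟩; exact inf_le_right) : sSup _ ≤ K) (hBK hb)
  have hBspan : ∀ x ∈ K, x ∈ Submodule.span k B := fun x hx => by
    obtain ⟨s, hs, hxs⟩ := hK x hx
    exact Submodule.span_mono Set.inter_subset_left (hspan _ ⟨s, hs, rfl⟩ ⟨hxs, hx⟩)
  have key : ∀ b : B, ∃ f : E →ₗ[k] k, f b = 1 ∧ (∀ c : B, b ≠ c → f c = 0) ∧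
      ∀ s : S, b.1 ∉ P s → ∀ x ∈ P s, f x = 0 := by
    intro b
    -- If `b = n + c` with `n` in a step missing `b` and `c` in the span of the other basis vectors,
    -- then `n = b - c` lies in `K`. By adaptedness `n` is spanned by basis vectors in that step,
    -- none of which is `b`; this contradicts independence.
    have hb : b.1 ∉ (⨆ s : {s : S // b.1 ∉ P s}, P s) ⊔ Submodule.span k (B \ {b.1}) := by
      intro h
      obtain ⟨n, hn, c, hc, hnc⟩ := Submodule.mem_sup.1 h
      have hbs : b.1 ∉ Submodule.span k (B \ {b.1}) := by simpa using hB.notMem_span b.2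
      have hnmem : n ∈ Submodule.span k (B \ {b.1}) := by
        rcases isEmpty_or_nonempty {s : S // b.1 ∉ P s} with he | he
        · rw [iSup_of_empty, Submodule.mem_bot] at hn
          exact hn ▸ zero_mem _
        · rw [Submodule.mem_iSup_of_directed _
            (Monotone.directed_le fun s t h => hP h : Directed (· ≤ ·)
              fun s : {s : S // b.1 ∉ P s} => P s)] at hn
          obtain ⟨⟨s, hs⟩, hn⟩ := hn
          have hfs : FiniteDimensional k (P s) := (hfd s).resolve_right fun h => hs (h ▸ trivial)
          have hnK : n ∈ K := by
            rw [eq_sub_of_add_eq hnc]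
            exact sub_mem (hBK _ b.2)
              (Submodule.span_le.2 (fun x hx => hBK x hx.1 : B \ {b.1} ⊆ K) hc)
          refine Submodule.span_mono ?_ (hspan _ ⟨s, hfs, rfl⟩ ⟨hn, hnK⟩)
          rintro x ⟨hxB, hx⟩
          exact ⟨hxB, fun hxb => hs (hxb ▸ hx.1)⟩
      have hadd := add_mem hnmem hc
      rw [hnc] at hadd
      exact hbs hadd
    obtain ⟨f, hf, hle⟩ := Submodule.exists_le_ker_of_notMem hb
    refine ⟨(f b.1)⁻¹ • f, by simp [hf], fun c hbc => ?_, fun s hs x hx => ?_⟩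
    · have : f c = 0 := hle (Submodule.mem_sup_right
        (Submodule.subset_span ⟨c.2, fun h => hbc (Subtype.ext h.symm)⟩))
      simp [this]
    · have : f x = 0 := hle (Submodule.mem_sup_left
        (Submodule.mem_iSup_of_mem (⟨s, hs⟩ : {s : S // b.1 ∉ P s}) hx))
      simp [this]
  choose f hf1 hf2 hf3 using key
  refine ⟨B, f, fun b => hBK _ b.2, hf1, hf2, hf3, fun x hx h0 => ?_⟩
  have hx' := hBspan x hx
  rw [← Subtype.range_coe (s := B), Finsupp.mem_span_range_iff_exists_finsupp] at hx'
  obtain ⟨c, rfl⟩ := hx'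
  have hc : c = 0 := by
    ext b
    have := h0 b
    rw [map_finsuppSum, Finsupp.sum, Finset.sum_eq_single b] at this
    · simpa [hf1] using this
    · intro d _ hd
      simp [hf2 b d hd.symm]
    · intro hb
      simp [Finsupp.notMem_support_iff.1 hb]
  simp [hc]

/-- Linearly independent functionals on a finite-dimensional space are separated by vectors. -/
theorem exists_dual_vector [FiniteDimensional k E] {J : Type*} {φ : J → Module.Dual k E}
    (hφ : LinearIndependent k φ) (i : J) : ∃ x, φ i x = 1 ∧ ∀ j, j ≠ i → φ j x = 0 := by
  have h : φ i ∉ Submodule.span k (φ '' {i}ᶜ) := hφ.notMem_span_image (by simp)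
  obtain ⟨F, hF, hle⟩ := Submodule.exists_le_ker_of_notMem h
  obtain ⟨x, hx⟩ := (Module.evalEquiv k E).surjective ((F (φ i))⁻¹ • F)
  have hx' : ∀ j, φ j x = (F (φ i))⁻¹ * F (φ j) := fun j => by
    simpa using congrArg (fun g => g (φ j)) hx
  refine ⟨x, by rw [hx', inv_mul_cancel₀ hF], fun j hj => ?_⟩
  have : F (φ j) = 0 := hle (Submodule.subset_span ⟨j, hj, rfl⟩)
  rw [hx', this, mul_zero]

end LinearAlgebra

/-! ### Colimits over lower sets and interval functionals -/

section Decomposition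

variable {R : Type u} [LinearOrder R] {k : Type v} [Field k]

theorem transition_self (V : R ⥤ ModuleCat.{w} k) (t : R) (x : V.obj t) :
    transition V (le_refl t) x = x :=
  congrArg (fun g => g.hom x) (V.map_id t)

theorem transition_transition (V : R ⥤ ModuleCat.{w} k) {s t u : R} (h : s ≤ t) (h' : t ≤ u)
    (x : V.obj s) : transition V h' (transition V h x) = transition V (h.trans h') x :=
  (congrArg (fun g => g.hom x) (V.map_comp (homOfLE h) (homOfLE h'))).symm

/-- In a radical module every vector comes from an earlier index. -/
theorem IsRadicalModule.exists_lift {V : R ⥤ ModuleCat.{w} k} (hV : IsRadicalModule V)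
    {t : R} (x : V.obj t) (hx : x ≠ 0) :
    ∃ (s : R) (h : s < t) (y : V.obj s), transition V h.le y = x := by
  have hmem : x ∈ radAt V t := hV t ▸ Submodule.mem_top
  rw [radAt] at hmem
  rcases isEmpty_or_nonempty {s : R // s < t} with he | he
  · rw [iSup_of_empty, Submodule.mem_bot] at hmem
    exact absurd hmem hx
  · have hdir : Directed (· ≤ ·)
        fun s : {s : R // s < t} => LinearMap.range (transition V s.2.le) := by
      refine Monotone.directed_le fun s r h => ?_
      rintro _ ⟨y, rfl⟩
      exact ⟨transition V h y, transition_transition V h r.2.le y⟩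
    obtain ⟨⟨s, hs⟩, y, hy⟩ := (Submodule.mem_iSup_of_directed _ hdir).1 hmem
    exact ⟨s, hs, y, hy⟩

open Classical in
/-- The colimit of a persistence module over a lower set of indices. -/
noncomputable abbrev ColimOver (V : R ⥤ ModuleCat.{w} k) (D : LowerSet R) : Type (max u w) :=
  Module.DirectLimit (fun s : D => V.obj s.1) fun _ _ h => transition V h

open Classical in
/-- The map from the value at an index to the colimit over a lower set containing it. -/
noncomputable def toColim (V : R ⥤ ModuleCat.{w} k) (D : LowerSet R) (s : D) :
    V.obj s.1 →ₗ[k] ColimOver V D :=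
  Module.DirectLimit.of k D (fun s : D => V.obj s.1) (fun _ _ h => transition V h) s

theorem toColim_transition (V : R ⥤ ModuleCat.{w} k) (D : LowerSet R) {s t : D} (h : s.1 ≤ t.1)
    (x : V.obj s.1) : toColim V D t (transition V h x) = toColim V D s x :=
  Module.DirectLimit.of_f (G := fun s : D => V.obj s.1) (f := fun _ _ h => transition V h)
    (i := s) (j := t) (hij := h) (x := x)

theorem exists_transition_eq_zero {V : R ⥤ ModuleCat.{w} k} {D : LowerSet R} {s : D}
    {x : V.obj s.1} (hx : toColim V D s x = 0) :
    ∃ (t : D) (h : s.1 ≤ t.1), transition V h x = 0 := by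
  have : DirectedSystem (fun s : D => V.obj s.1)
      fun s t (h : s ≤ t) => ⇑(transition V (show s.1 ≤ t.1 from h)) :=
    ⟨fun t x => transition_self V t.1 x, fun _ _ _ h h' x => transition_transition V h h' x⟩
  exact Module.DirectLimit.of.zero_exact hx

/-- The vectors at index `s` that vanish at all indices outside `D`. -/
def dying (V : R ⥤ ModuleCat.{w} k) (D : LowerSet R) (s : R) : Submodule k (V.obj s) where
  carrier := {x | ∀ (u : R) (h : s ≤ u), u ∉ D → transition V h x = 0}
  add_mem' hx hy u h hu := by rw [map_add, hx u h hu, hy u h hu, add_zero]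
  zero_mem' u h hu := map_zero _
  smul_mem' c x hx u h hu := by rw [map_smul, hx u h hu, smul_zero]

theorem transition_mem_dying {V : R ⥤ ModuleCat.{w} k} {D : LowerSet R} {s t : R} (h : s ≤ t)
    {x : V.obj s} (hx : x ∈ dying V D s) : transition V h x ∈ dying V D t := fun u hu huD => by
  rw [transition_transition, hx u _ huD]

/-- The vectors of the colimit over `D` that vanish at all indices outside `D`. -/
noncomputable def dyingColim (V : R ⥤ ModuleCat.{w} k) (D : LowerSet R) :
    Submodule k (ColimOver V D) :=
  ⨆ s : D, (dying V D s.1).map (toColim V D s)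

/-- The union is directed; `x ≠ 0` excludes the empty `D`, which has no index to offer. -/
theorem mem_dyingColim {V : R ⥤ ModuleCat.{w} k} {D : LowerSet R} {x : ColimOver V D}
    (hx : x ∈ dyingColim V D) (hx0 : x ≠ 0) : ∃ s : D, ∃ y ∈ dying V D s.1, toColim V D s y = x := by
  rw [dyingColim] at hx
  rcases isEmpty_or_nonempty D with he | he
  · rw [iSup_of_empty, Submodule.mem_bot] at hx
    exact absurd hx hx0
  · rw [Submodule.mem_iSup_of_directed] at hx
    · obtain ⟨s, y, hy, rfl⟩ := hx
      exact ⟨s, y, hy, rfl⟩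
    · refine Monotone.directed_le fun s t h => ?_
      rintro _ ⟨y, hy, rfl⟩
      exact ⟨_, transition_mem_dying (t := t.1) h hy, toColim_transition V D h y⟩

theorem toColim_mem_dyingColim {V : R ⥤ ModuleCat.{w} k} {D : LowerSet R} (s : D)
    {x : V.obj s.1} (hx : x ∈ dying V D s.1) : toColim V D s x ∈ dyingColim V D :=
  Submodule.mem_iSup_of_mem s ⟨x, hx, rfl⟩

/-- Equality in the colimit is already equality at some index of `D`, and every index outside `D`
lies above that one. -/
theorem mem_dying_of_toColim_mem {V : R ⥤ ModuleCat.{w} k} {D : LowerSet R} {s : D}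
    {x : V.obj s.1} (hx : toColim V D s x ∈ dyingColim V D) : x ∈ dying V D s.1 := by
  have key : ∃ (r : D) (h : s.1 ≤ r.1), transition V h x ∈ dying V D r.1 := by
    by_cases h0 : toColim V D s x = 0
    · obtain ⟨r, h, hr⟩ := exists_transition_eq_zero h0
      exact ⟨r, h, hr ▸ zero_mem _⟩
    · obtain ⟨t, y, hy, hyx⟩ := mem_dyingColim hx h0
      obtain ⟨m, hsm, htm⟩ : ∃ m : D, s.1 ≤ m.1 ∧ t.1 ≤ m.1 :=
        ⟨max s t, le_max_left s t, le_max_right s t⟩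
      have hz : toColim V D m (transition V hsm x - transition V htm y) = 0 := by
        rw [map_sub, toColim_transition, toColim_transition, hyx, sub_self]
      obtain ⟨r, h, hr⟩ := exists_transition_eq_zero hz
      rw [map_sub, transition_transition, transition_transition, sub_eq_zero] at hr
      exact ⟨r, hsm.trans h, hr ▸ transition_mem_dying _ hy⟩
  obtain ⟨r, hsr, hr⟩ := key
  intro u hsu hu
  have hru : r.1 ≤ u := le_of_not_ge fun h => hu (D.lower h r.2)
  rw [← hr u hru hu, transition_transition]

/-- Vectors and functionals on the colimit over `D` that give the interval summands ending
with `D`. -/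
theorem exists_colim_functionals {V : R ⥤ ModuleCat.{w} k} (hq : IsQTame V)
    (hr : IsRadicalModule V) (D : LowerSet R) :
    ∃ (B : Set (ColimOver V D)) (f : B → ColimOver V D →ₗ[k] k),
      (∀ b : B, b.1 ∈ dyingColim V D) ∧ (∀ b : B, f b b = 1) ∧ (∀ b c : B, b ≠ c → f b c = 0) ∧
      (∀ (b : B) (s : D), b.1 ∉ LinearMap.range (toColim V D s) → ∀ x, f b (toColim V D s x) = 0) ∧
      ∀ x ∈ dyingColim V D, (∀ b, f b x = 0) → x = 0 := by
  have hmono : Monotone fun s : D => LinearMap.range (toColim V D s) := by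
    rintro s t h _ ⟨y, rfl⟩
    exact ⟨_, toColim_transition V D h y⟩
  -- The map to the colimit factors through the finite-rank map `V s → V t`.
  have hfd : ∀ s t : D, s.1 < t.1 → FiniteDimensional k (LinearMap.range (toColim V D s)) := by
    intro s t h
    have := hq h
    have he : LinearMap.range (toColim V D s) =
        (LinearMap.range (transition V h.le)).map (toColim V D t) := by
      rw [← LinearMap.range_comp]
      congr 1
      ext x
      exact (toColim_transition V D h.le x).symm
    rw [he]
    infer_instance
  have hlt : ∀ (s : D) (y : V.obj s.1), toColim V D s y ≠ 0 →
      ∃ t : D, t.1 < s.1 ∧ toColim V D s y ∈ LinearMap.range (toColim V D t) := by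
    intro s y hy
    obtain ⟨t, hts, z, rfl⟩ := hr.exists_lift y fun h => hy (by rw [h, map_zero])
    exact ⟨⟨t, D.lower hts.le s.2⟩, hts, z,
      (toColim_transition V D (s := ⟨t, D.lower hts.le s.2⟩) hts.le z).symm⟩
  rcases isEmpty_or_nonempty D with he | he
  · have h0 : dyingColim V D = ⊥ := by rw [dyingColim, iSup_of_empty]
    refine ⟨∅, fun _ => 0, fun b => b.2.elim, fun b => b.2.elim, fun b => b.2.elim,
      fun b => b.2.elim, fun x hx _ => ?_⟩
    rwa [h0, Submodule.mem_bot] at hx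
  -- A nonzero map is needed below: radicality then supplies indices `t₀ < s₀` in `D`, hence a
  -- finite-dimensional step to contain the zero vector.
  by_cases hsub : ∀ s : D, toColim V D s = 0
  · refine ⟨∅, fun _ => 0, fun b => b.2.elim, fun b => b.2.elim, fun b => b.2.elim,
      fun b => b.2.elim, fun x hx _ => by_contra fun hx0 => ?_⟩
    obtain ⟨s, y, -, rfl⟩ := mem_dyingColim hx hx0
    exact hx0 (by rw [hsub s]; rfl)
  push Not at hsub
  obtain ⟨s₀, hs₀⟩ := hsub
  obtain ⟨y₀, hy₀⟩ : ∃ y, toColim V D s₀ y ≠ 0 := by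
    by_contra! h
    exact hs₀ (LinearMap.ext h)
  obtain ⟨t₀, ht₀, -⟩ := hlt s₀ y₀ hy₀
  obtain ⟨B, f, h1, h2, h3, h4, h5⟩ := exists_adapted_functionals (dyingColim V D)
    (fun s : D => LinearMap.range (toColim V D s)) hmono (by
      intro s
      -- At a greatest index of `D` the image may be infinite-dimensional, but it is the whole
      -- colimit.
      by_cases hs : ∃ t : D, s.1 < t.1
      · obtain ⟨t, ht⟩ := hs
        exact Or.inl (hfd s t ht)
      · push Not at hs
        right
        rw [eq_top_iff]
        rintro x -
        obtain ⟨t, y, rfl⟩ := Module.DirectLimit.exists_of x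
        exact ⟨_, toColim_transition V D (hs t) y⟩) (by
      intro x hx
      by_cases hx0 : x = 0
      · exact ⟨t₀, hfd t₀ s₀ ht₀, hx0 ▸ zero_mem _⟩
      · obtain ⟨s, y, -, rfl⟩ := mem_dyingColim hx hx0
        obtain ⟨t, hts, hmem⟩ := hlt s y hx0
        exact ⟨t, hfd t s hts, hmem⟩)
  exact ⟨B, f, h1, h2, h3, fun b s hb x => h4 b s hb _ ⟨x, rfl⟩, h5⟩

/-- A q-tame radical module has enough functionals: a family of maps to interval modules that
identifies it with the direct sum of these interval modules. -/
theorem exists_interval_functionals {V : R ⥤ ModuleCat.{w} k} (hq : IsQTame V)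
    (hr : IsRadicalModule V) :
    ∃ (ι : Type (max u w)) (I : ι → OrdInterval R) (φ : ι → ∀ t, V.obj t →ₗ[k] k),
      (∀ i t, t ∉ (I i).carrier → φ i t = 0) ∧
      (∀ i s t (h : s ≤ t), t ∈ (I i).carrier → ∀ x, φ i t (transition V h x) = φ i s x) ∧
      (∀ t x, (∀ i, φ i t x = 0) → x = 0) ∧
      (∀ t x, {i | φ i t x ≠ 0}.Finite) ∧
      ∀ i, ∀ t ∈ (I i).carrier, ∃ x, φ i t x = 1 ∧ ∀ j, j ≠ i → φ j t x = 0 := by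
  classical
  choose B f hBK hf1 hf0 hfP hsep using exists_colim_functionals hq hr
  let ι := Σ D : LowerSet R, B D
  let I : ι → OrdInterval R := fun i =>
    { carrier := {s | ∃ h : s ∈ i.1, i.2.1 ∈ LinearMap.range (toColim V i.1 ⟨s, h⟩)}
      nonempty := by
        have hb0 : i.2.1 ≠ 0 := fun h => by
          have := hf1 i.1 i.2
          rw [h, map_zero] at this
          exact zero_ne_one this
        obtain ⟨s, y, -, hy⟩ := mem_dyingColim (hBK i.1 i.2) hb0
        exact ⟨s.1, s.2, y, hy⟩
      convex := by
        rintro s u t ⟨hs, y, hy⟩ ⟨ht, -⟩ hsu hut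
        have hu := i.1.lower hut ht
        refine ⟨hu, transition V hsu y, ?_⟩
        rw [← hy]
        exact toColim_transition V i.1 (s := ⟨s, hs⟩) (t := ⟨u, hu⟩) hsu y }
  let φ : ι → ∀ t, V.obj t →ₗ[k] k := fun i t =>
    if h : t ∈ i.1 then f i.1 i.2 ∘ₗ toColim V i.1 ⟨t, h⟩ else 0
  have φ_of_mem : ∀ (i : ι) t (h : t ∈ i.1) x, φ i t x = f i.1 i.2 (toColim V i.1 ⟨t, h⟩ x) := by
    intro i t h x
    simp only [φ, dif_pos h, LinearMap.comp_apply]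
  have hφ0 : ∀ i t, t ∉ (I i).carrier → φ i t = 0 := by
    intro i t ht
    by_cases h : t ∈ i.1
    · ext x
      rw [φ_of_mem i t h]
      exact hfP i.1 i.2 ⟨t, h⟩ (fun hb => ht ⟨h, hb⟩) x
    · exact dif_neg h
  have φ_lower : ∀ (i : ι) s t (h : s ≤ t), t ∈ i.1 → ∀ x, φ i t (transition V h x) = φ i s x := by
    intro i s t h ht x
    rw [φ_of_mem i t ht, φ_of_mem i s (i.1.lower h ht)]
    exact congrArg _ (toColim_transition V i.1 (s := ⟨s, i.1.lower h ht⟩) (t := ⟨t, ht⟩) h x)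
  have hφ : ∀ i s t (h : s ≤ t), t ∈ (I i).carrier → ∀ x, φ i t (transition V h x) = φ i s x :=
    fun i s t h ht => φ_lower i s t h ht.1
  have mem_of_ne : ∀ i t x, φ i t x ≠ 0 → t ∈ (I i).carrier := fun i t x h =>
    by_contra fun ht => h (by rw [hφ0 i t ht]; rfl)
  -- Test the functionals on the images at `t` of lifts `y i` to `V s` of the basis vectors: the
  -- resulting matrix is unitriangular for the order of the lower sets.
  have indep : ∀ s t (h : s < t), LinearIndependent k
      fun i : {i : ι // s ∈ (I i).carrier ∧ t ∈ (I i).carrier} =>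
        φ i.1 t ∘ₗ (LinearMap.range (transition V h.le)).subtype := by
    intro s t h
    have hy : ∀ i : {i : ι // s ∈ (I i).carrier ∧ t ∈ (I i).carrier},
        ∃ y, y ∈ dying V i.1.1 s ∧
          toColim V i.1.1 ⟨s, i.2.1.1⟩ y = i.1.2.1 := by
      intro i
      obtain ⟨y, hy⟩ := i.2.1.2
      exact ⟨y, mem_dying_of_toColim_mem (s := ⟨s, i.2.1.1⟩) (hy ▸ hBK i.1.1 i.1.2), hy⟩
    choose y hyd hyb using hy
    have hval : ∀ i j, i.1.1 ≤ j.1.1 →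
        φ j.1 t (transition V h.le (y i)) = if j = i then 1 else 0 := by
      rintro i j hij
      rcases hij.eq_or_lt with hij | hij
      · obtain ⟨⟨D, b⟩, hi⟩ := i
        obtain ⟨⟨D', c⟩, hj⟩ := j
        obtain rfl : D = D' := hij
        rw [φ_lower _ _ _ _ hj.2.1, φ_of_mem ⟨D, c⟩ s hi.1.1, hyb ⟨⟨D, b⟩, hi⟩]
        by_cases hbc : c = b
        · subst hbc
          simpa using hf1 D c
        · rw [hf0 D c b hbc, if_neg]
          intro he
          exact hbc (eq_of_heq (Sigma.mk.inj (congrArg Subtype.val he)).2)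
      -- At `u`, in the larger lower set only, `y i` has died, while the functional of `j` can still
      -- be computed there.
      · obtain ⟨u, huj, hui⟩ := Set.not_subset.1 fun hji => hij.not_ge (show j.1.1 ≤ i.1.1 from hji)
        have htu : t ≤ u := le_of_not_ge fun h' => hui (i.1.1.lower h' i.2.2.1)
        rw [if_neg (fun he => hij.ne (by rw [he])), ← φ_lower j.1 t u htu huj,
          transition_transition, hyd i u _ hui, map_zero]
    rw [linearIndependent_iff']
    intro F g hg
    by_contra! hne
    -- Evaluating a relation at the vector of a smallest lower set in its support isolates one
    -- coefficient.
    obtain ⟨i, hi, hmin⟩ := Finset.exists_min_image (F.filter fun i => g i ≠ 0) (fun i => i.1.1)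
      (by obtain ⟨i, hi, hgi⟩ := hne; exact ⟨i, Finset.mem_filter.2 ⟨hi, hgi⟩⟩)
    obtain ⟨hiF, hgi⟩ := Finset.mem_filter.1 hi
    apply hgi
    have hev := LinearMap.congr_fun hg ⟨transition V h.le (y i), y i, rfl⟩
    rw [LinearMap.sum_apply, Finset.sum_eq_single_of_mem i hiF] at hev
    · simpa [hval i i le_rfl] using hev
    · intro j hj hji
      by_cases hgj : g j = 0
      · simp [hgj]
      · have := hval i j (hmin j (Finset.mem_filter.2 ⟨hj, hgj⟩))
        simp [this, hji]
  refine ⟨ι, I, φ, hφ0, hφ, fun t x hx => ?_, fun t x => ?_, fun i t ht => ?_⟩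
  · by_contra hx0
    -- The indices at which `x` has not yet died.
    let D : LowerSet R :=
      { carrier := {u | ∀ h : t ≤ u, transition V h x ≠ 0}
        lower' := fun u u' hu' hu h h0 => hu (h.trans hu') (by
          rw [← transition_transition V h hu', h0, map_zero]) }
    have ht : t ∈ D := fun h => by rwa [transition_self]
    have hxd : x ∈ dying V D t := fun u h hu => by
      by_contra hne
      exact hu fun _ => hne
    have h0 := hsep D _ (toColim_mem_dyingColim ⟨t, ht⟩ hxd) fun b => by
      rw [← φ_of_mem ⟨D, b⟩ t ht, hx]
    obtain ⟨u, h, hu⟩ := exists_transition_eq_zero h0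
    exact u.2 h hu
  · by_cases hx0 : x = 0
    · simp [hx0]
    -- A functional nonzero on `x` is nonzero on the lift `y`, so its interval contains both `s` and
    -- `t`; independence bounds their number.
    obtain ⟨s, hst, y, rfl⟩ := hr.exists_lift x hx0
    have := hq hst
    have hfin : Finite {i : ι // s ∈ (I i).carrier ∧ t ∈ (I i).carrier} :=
      (indep s t hst).finite
    refine (Set.finite_coe_iff.1 hfin : {i : ι | s ∈ (I i).carrier ∧ t ∈ (I i).carrier}.Finite).subset fun i hi => ?_
    have ht := mem_of_ne i t _ hi
    exact ⟨mem_of_ne i s y (by rwa [← hφ i s t hst.le ht]), ht⟩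
  · obtain ⟨htD, z, hz⟩ := ht
    have hz0 : z ≠ 0 := fun h => by
      have := hf1 i.1 i.2
      rw [← hz, h, map_zero, map_zero] at this
      exact zero_ne_one this
    -- Lifting the representative of the basis vector shows that the interval of `i` also contains
    -- some `s < t`, so independence applies to it.
    obtain ⟨s, hst, y, rfl⟩ := hr.exists_lift z hz0
    have hs : s ∈ (I i).carrier := ⟨i.1.lower hst.le htD, y, by
      rw [← hz]
      exact (toColim_transition V i.1 (s := ⟨s, i.1.lower hst.le htD⟩)
        (t := ⟨t, htD⟩) hst.le y).symm⟩
    have := hq hst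
    obtain ⟨⟨_, x, rfl⟩, hx1, hx0⟩ := exists_dual_vector (indep s t hst) ⟨i, hs, htD, _, hz⟩
    refine ⟨transition V hst.le x, hx1, fun j hj => ?_⟩
    by_cases hjs : s ∈ (I j).carrier
    · by_cases hjt : t ∈ (I j).carrier
      · exact hx0 ⟨j, hjs, hjt⟩ fun h => hj (congrArg Subtype.val h)
      · rw [hφ0 j t hjt]; rfl
    · by_cases hjt : t ∈ (I j).carrier
      · rw [hφ j s t hst.le hjt, hφ0 j s hjs]; rfl
      · rw [hφ0 j t hjt]; rfl

end Decomposition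

/-- Every q-tame radical persistence module is a direct sum of interval modules. The summands are
found through functionals on colimits rather than through elements of inverse limits, so that
left separability of the intervals of `R` is not needed. -/
theorem exists_iso_directSum_intervalModule {R : Type u} [LinearOrder R] {k : Type v} [Field k]
    {V : R ⥤ ModuleCat.{max u v w} k} (hq : IsQTame V) (hr : IsRadicalModule V) :
    ∃ (ι : Type (max u v w)) (I : ι → OrdInterval R),
      Nonempty (V ≅ directSum fun i => intervalModule.{u, v, max u w} k (I i)) := by
  classical
  obtain ⟨ι, I, φ, h0, hφ, hinj, hfin, hsurj⟩ := exists_interval_functionals hq hr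
  let c : ∀ i t, V.obj t →ₗ[k] ULift.{max u w} (intervalSpace k (I i) t) := fun i t =>
    ULift.moduleEquiv.symm.toLinearMap ∘ₗ (φ i t).codRestrict (intervalSpace k (I i) t)
      fun x ht => by rw [h0 i t ht]; rfl
  have hc : ∀ i t x, (c i t x).down.1 = φ i t x := fun _ _ _ => rfl
  have hc0 : ∀ i t x, c i t x = 0 ↔ φ i t x = 0 := fun i t x => by
    rw [← hc]
    exact ⟨fun h => by rw [h]; rfl, fun h => ULift.ext _ _ (Subtype.ext h)⟩
  let g₀ : ∀ t, V.obj t → Π₀ i, ULift.{max u w} (intervalSpace k (I i) t) := fun t x =>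
    DFinsupp.mk (hfin t x).toFinset fun i => c i t x
  have hg₀ : ∀ t x i, g₀ t x i = c i t x := by
    intro t x i
    by_cases h : φ i t x = 0
    · exact (dif_neg (by simpa using h)).trans ((hc0 i t x).2 h).symm
    · exact dif_pos (by simpa using h)
  let g : ∀ t, V.obj t →ₗ[k] Π₀ i, ULift.{max u w} (intervalSpace k (I i) t) := fun t =>
    { toFun := g₀ t
      map_add' := fun x y => DFinsupp.ext fun i => by
        rw [DFinsupp.add_apply, hg₀, hg₀, hg₀, map_add]
      map_smul' := fun a x => DFinsupp.ext fun i => by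
        rw [DFinsupp.smul_apply, hg₀, hg₀, map_smul]; rfl }
  have hg : ∀ t x i, g t x i = c i t x := hg₀
  have hbij : ∀ t, Function.Bijective (g t) := by
    intro t
    refine ⟨(injective_iff_map_eq_zero _).2 fun x hx => hinj t x fun i => ?_, ?_⟩
    · rw [← hc0, ← hg, hx]; rfl
    · rw [← LinearMap.range_eq_top, eq_top_iff]
      rintro z -
      induction z using DFinsupp.induction with
      | h0 => exact zero_mem _
      | ha i b z _ _ hz =>
        refine add_mem ?_ hz
        by_cases ht : t ∈ (I i).carrier
        · obtain ⟨x, hx1, hx0⟩ := hsurj i t ht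
          refine ⟨b.down.1 • x, DFinsupp.ext fun j => ?_⟩
          rw [hg]
          by_cases hj : j = i
          · subst hj
            rw [DFinsupp.single_eq_same]
            refine ULift.ext _ _ (Subtype.ext ?_)
            rw [hc, map_smul, hx1, smul_eq_mul, mul_one]
          · rw [DFinsupp.single_eq_of_ne hj, hc0, map_smul, hx0 j hj, smul_zero]
        · have hb : b = 0 := ULift.ext _ _ (Subtype.ext (b.down.2 ht))
          rw [hb, DFinsupp.single_zero]
          exact zero_mem _
  refine ⟨ι, I, ⟨NatIso.ofComponents
    (fun t => (LinearEquiv.ofBijective (g t) (hbij t)).toModuleIso) ?_⟩⟩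
  intro s t f
  refine ModuleCat.hom_ext (LinearMap.ext fun x => DFinsupp.ext fun i => ?_)
  change g t (transition V (leOfHom f) x) i =
    ((intervalModule.{u, v, max u w} k (I i)).map f).hom (g s x i)
  rw [hg, hg]
  refine ULift.ext _ _ (Subtype.ext ?_)
  change φ i t _ = if t ∈ (I i).carrier then φ i s x else 0
  split_ifs with ht
  · exact hφ i s t _ ht x
  · rw [h0 i t ht]; rfl

/-! ### The radical and the observable category -/

variable {R : Type u} [LinearOrder R] {k : Type v} [Field k]

theorem isEphemeral_of_isZero {V : R ⥤ ModuleCat.{w} k} (hV : IsZero V) : IsEphemeral V := by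
  intro s t h
  have hz : IsZero (V.obj t) := (Functor.isZero_iff V).1 hV t
  have := ModuleCat.subsingleton_of_isZero hz
  ext x
  exact Subsingleton.elim _ _

instance mono_radInclusion (V : R ⥤ ModuleCat.{w} k) : Mono (radInclusion V) := by
  have : ∀ t, Mono ((radInclusion V).app t) := fun t =>
    (ModuleCat.mono_iff_injective _).2 Subtype.val_injective
  exact NatTrans.mono_of_mono_app _

theorem transition_mem_radAt (V : R ⥤ ModuleCat.{w} k) {s t : R} (h : s < t) (x : V.obj s) :
    transition V h.le x ∈ radAt V t :=
  Submodule.mem_iSup_of_mem (⟨s, h⟩ : {s // s < t}) ⟨x, rfl⟩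

/-- A structure map with strictly increasing indices, as a map to the radical. -/
noncomputable def toRad (V : R ⥤ ModuleCat.{w} k) {s t : R} (h : s < t) : V.obj s ⟶ (rad V).obj t :=
  ModuleCat.ofHom ((transition V h.le).codRestrict (radAt V t) (transition_mem_radAt V h))

/-- The kernel is zero, and a strict structure map of `V` factors through the radical, hence
vanishes in the cokernel. -/
theorem isWeakIso_radInclusion (V : R ⥤ ModuleCat.{w} k) : IsWeakIso (radInclusion V) := by
  refine ⟨isEphemeral_of_isZero (isZero_kernel_of_mono _), fun s t h => ?_⟩
  have hzero : (cokernel (radInclusion V)).map (homOfLE h.le) = 0 := by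
    rw [← cancel_epi ((cokernel.π (radInclusion V)).app s), comp_zero,
      ← (cokernel.π (radInclusion V)).naturality]
    have hfac : V.map (homOfLE h.le) = toRad V h ≫ (radInclusion V).app t := rfl
    rw [hfac, Category.assoc, ← NatTrans.comp_app, cokernel.condition]
    exact comp_zero
  exact congrArg ModuleCat.Hom.hom hzero

/-- By density `V s → V t` passes through some `V u` with `s < u < t`, where its image already lies
in the radical. -/
theorem isRadicalModule_rad [DenselyOrdered R] (V : R ⥤ ModuleCat.{w} k) :
    IsRadicalModule (rad V) := by
  intro t
  have hle : radAt V t ≤ (radAt (rad V) t).map (radAt V t).subtype := by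
    refine iSup_le ?_
    rintro ⟨s, hs⟩ _ ⟨y, rfl⟩
    obtain ⟨u, hsu, hut⟩ := exists_between hs
    refine ⟨_, transition_mem_radAt (rad V) hut (toRad V hsu y), ?_⟩
    exact transition_transition V hsu.le hut.le y
  rw [eq_top_iff]
  rintro x -
  obtain ⟨y, hy, hyx⟩ := hle x.2
  exact Subtype.ext (a1 := y) (a2 := x) hyx ▸ hy

theorem isQTame_rad {V : R ⥤ ModuleCat.{w} k} (hV : IsQTame V) : IsQTame (rad V) := by
  intro s t h
  have := hV h
  have hle : (LinearMap.range (transition (rad V) h.le)).map (radAt V t).subtype ≤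
      LinearMap.range (transition V h.le) := by
    rintro _ ⟨_, ⟨x, rfl⟩, rfl⟩
    exact ⟨x.1, rfl⟩
  have hfd := Submodule.finiteDimensional_of_le hle
  exact Module.Finite.equiv
    (Submodule.equivMapOfInjective (radAt V t).subtype Subtype.val_injective _).symm

/-- In the observable category a persistence module is isomorphic to its radical. -/
noncomputable def radObIso [DenselyOrdered R] (V : R ⥤ ModuleCat.{w} k) :
    (toOb R k).obj (rad V) ≅ (toOb R k).obj V where
  hom := (toOb R k).map (radInclusion V)
  inv :=
    { app := fun _ _ h => toRad V h
      comm := fun s u v t hsu huv hvt => by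
        refine ModuleCat.hom_ext (LinearMap.ext fun x => Subtype.ext ?_)
        change transition V _ x = transition V hvt (transition V huv.le (transition V hsu x))
        rw [transition_transition, transition_transition] }
  hom_inv_id := by
    refine ObHom.ext ?_
    funext s t h
    obtain ⟨u, hsu, hut⟩ := exists_between h
    refine (ObHom.comp_app _ _ hsu hut).trans ?_
    refine ModuleCat.hom_ext (LinearMap.ext fun x => Subtype.ext ?_)
    exact transition_transition V hsu.le hut.le x.1
  inv_hom_id := by
    refine ObHom.ext ?_
    funext s t h
    obtain ⟨u, hsu, hut⟩ := exists_between h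
    refine (ObHom.comp_app _ _ hsu hut).trans ?_
    refine ModuleCat.hom_ext (LinearMap.ext fun x => ?_)
    exact transition_transition V hsu.le hut.le x

open Classical in
/-- The observable morphism out of a direct sum determined by its restrictions to the summands. -/
noncomputable def obDirectSumDesc {ι : Type w} (F : ι → R ⥤ ModuleCat.{w} k) (W : R ⥤ ModuleCat.{w} k)
    (ψ : ∀ i, ObHom (F i) W) : ObHom (directSum F) W where
  app _ _ h := ModuleCat.ofHom (DFinsupp.lsum k fun i => ((ψ i).app h).hom)
  comm s u v t hsu huv hvt := by
    refine ModuleCat.hom_ext (DFinsupp.lhom_ext fun i x => ?_)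
    have h := congrArg (fun g => g.hom x) ((ψ i).comm hsu huv hvt)
    simp only [ModuleCat.hom_comp, LinearMap.comp_apply, directSum, ModuleCat.hom_ofHom,
      DFinsupp.lsum_single, DFinsupp.mapRange.linearMap_apply, DFinsupp.mapRange_single] at h ⊢
    exact h

/-- The direct sum is the coproduct in the observable category. -/
noncomputable def obDirectSumIsColimit [DenselyOrdered R] {ι : Type w} (F : ι → R ⥤ ModuleCat.{w} k) :
    IsColimit (obDirectSumCofan F) := by
  classical
  refine Cofan.IsColimit.mk _ (fun c => obDirectSumDesc F c.pt.pers fun i => c.inj i) ?_ ?_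
  · intro c i
    refine ObHom.ext ?_
    funext s t h
    obtain ⟨u, hsu, hut⟩ := exists_between h
    refine (ObHom.comp_app _ _ hsu hut).trans ?_
    rw [← ObHom.map_app (c.inj i) hsu.le hut]
    refine ModuleCat.hom_ext (LinearMap.ext fun x => ?_)
    exact DFinsupp.lsum_single k (fun i => ((c.inj i).app hut).hom) i _
  · intro c m hm
    refine ObHom.ext ?_
    funext s t h
    refine ModuleCat.hom_ext (DFinsupp.lhom_ext fun i x => ?_)
    -- Composition in the observable category needs an intermediate index; naturality of the
    -- inclusion moves the structure map from `s` to `u` across it.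
    obtain ⟨u, hsu, hut⟩ := exists_between h
    have h1 := congrArg (fun g : ObHom (F i) c.pt.pers => (g.app h).hom x) (hm i)
    have h2 := (ObHom.comp_app (ObHom.ofHom (directSumInclusion F i)) m hsu hut)
    have h3 := ObHom.map_app m hsu.le hut
    refine Eq.trans ?_ (h1.trans (DFinsupp.lsum_single k (fun i => ((c.inj i).app h).hom) i x).symm)
    refine Eq.trans ?_ (congrArg (fun g => g.hom x) h2).symm
    rw [← h3]
    exact congrArg (fun g => (m.app hut).hom (g.hom x))
      ((directSumInclusion F i).naturality (homOfLE hsu.le)).symm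

end Persistence

theorem corollary3p4 (R : Type u) [LinearOrder R] (k : Type v) [Field k]
    (hsep : ∀ I : OrdInterval R, LeftSeparable I) :
    (∀ V : R ⥤ ModuleCat.{max u v w} k, IsQTame V → IsRadicalModule V →
      ∃ (ι : Type (max u v w)) (I : ι → OrdInterval R),
        Nonempty (V ≅ directSum fun i => intervalModule.{u, v, max u w} k (I i))) ∧
    (∀ [DenselyOrdered R],
      (∀ V : R ⥤ ModuleCat.{max u v w} k, IsRadicalModule (rad V) ∧ IsWeakIso (radInclusion V)) ∧
      (∀ V : R ⥤ ModuleCat.{max u v w} k, IsQTame V → IsQTame (rad V) ∧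
        ∃ (ι : Type (max u v w)) (I : ι → OrdInterval R),
          Nonempty (rad V ≅ directSum fun i => intervalModule.{u, v, max u w} k (I i)) ∧
          Nonempty ((toOb R k).obj V ≅
            (toOb R k).obj (directSum fun i => intervalModule.{u, v, max u w} k (I i))) ∧
          Nonempty (IsColimit
            (obDirectSumCofan fun i => intervalModule.{u, v, max u w} k (I i))))) := by
  refine ⟨fun V hq hr => exists_iso_directSum_intervalModule.{u, v, w} hq hr, ?_⟩
  intro _
  refine ⟨fun V => ⟨isRadicalModule_rad V, isWeakIso_radInclusion V⟩, fun V hq => ?_⟩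
  have hq' := isQTame_rad hq
  obtain ⟨ι, I, ⟨e⟩⟩ :=
    exists_iso_directSum_intervalModule.{u, v, w} hq' (isRadicalModule_rad V)
  exact ⟨hq', ι, I, ⟨e⟩, ⟨(radObIso V).symm ≪≫ (toOb R k).mapIso e⟩,
    ⟨obDirectSumIsColimit _⟩⟩
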